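/- Let $\mathcal M$ be an $O^\ast$-algebra with unit on a dense subspace $\mathcal D$ of a complex Hilbert space $\mathcal H$ (for instance $\mathcal M=dU(\mathcal E(\mathcal G))$ for a unitary representation $U$ of a Lie group). Let $X=\mathcal E_S(\mathcal M)$ be its state space: the positive operators $\hat\rho$ of trace one such that $\hat\rho$ is trace class, $\hat\rho\,\mathcal H\subset\mathcal D$, and $\hat A\hat\rho$ is trace class for every $\hat A\in\mathcal M$; $X$ carries the weakest topology making all functions $\hat\rho\mapsto \mathrm{Tr}(\hat A\hat\rho)$, $\hat A\in\mathcal M$, continuous. For open $V\subset X$ let $\mathbb A(V)$ be the set of locally linear functions on $V$, i.e. functions $V\to\mathbb R$ that near each point of $V$ have the form $a_Q(\hat\rho)=\mathrm{Tr}(\hat A\hat\rho)$ with $\hat A\in\mathcal M$ essentially self-adjoint, and let $\mathbb R_D(V)=C(V,\mathbb R)$ be the set of Dedekind qr-numbers defined to extent $V$. For $A\subset X$ with empty interior, an infinitesimal locally linear qr-number with support $A$, defined to extent an open set $U$, is a section over $U$ of the prolongation by zero of the restriction $\mathbb A|_A$: a family of germs $(s_\rho)_{\rho\in U}$ with $s_\rho=0$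 for $\rho\in U\setminus A$ and such that every $\rho\in U\cap A$ has an open neighbourhood $V\subset U$ and an $f\in\mathbb A(V)$ with $s_\sigma=\mathrm{germ}_\sigma f$ for all $\sigma\in V\cap A$. Infinitesimal qr-numbers with support $A$ are defined in the same way with $\mathbb R_D$ in place of $\mathbb A$. Writing $s(\rho)$ for the value of the germ $s_\rho$ at $\rho$, the logical extent of $s^2\neq0$ is the largest open set of points $\rho\in U$ at which $s(\rho)^2\ne0$, and $s$ is an intuitionistic nilsquare infinitesimal if $\lnot[s^2\ne 0]$ holds to extent $U$, i.e. $U$ is contained in the pseudo-complement (the largest disjoint open set) of that extent. **Theorem 6.** Let $W\subset X$ be open and let $F$ be a function from $\mathbb A$ to $\mathbb R_D$ defined to extent $W$, that is, a family of maps $F_V:\mathbb A(V)\to\mathbb R_D(V)$, $V\subset W$ open, compatible with restrictions. Suppose that there is a further such function $G$ with $F(a)^2=a^2\,G(a)$ for all $a\in\mathbb A(V)$ and all open $V\subset W$. Let $A\subset W$ have empty interior and let $a^0_Q$ be an infinitesimal locally linear qr-number with support $A$, defined to extent $U$ for some open $U\subset X$. Let $F(a^0_Q)$ be obtained by letting $F$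 act on germs at the points of $U\cap W$, and be zero at the points of $U\setminus W$. Then $F(a^0_Q)$ is again an infinitesimal qr-number with support $A$, and it is an intuitionistic nilsquare infinitesimal. -/

import Mathlib

open Topology TopologicalSpace Filter

noncomputable section

namespace QR

/-! ### Trace class operators on a complex Hilbert space -/

section Trace

variable {H : Type*} [NormedAddCommGroup H] [InnerProductSpace ℂ H] [CompleteSpace H]

variable (H) in
/-- The index set of a fixed orthonormal (Hilbert) basis of `H`. -/
def basisIndex : Set H := (exists_hilbertBasis ℂ H).choose

variable (H) in
/-- A fixed orthonormal (Hilbert) basis of `H`, used to compute traces. Traces of trace class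
operators do not depend on this choice. -/
def stdBasis : HilbertBasis (basisIndex H) ℂ H := (exists_hilbertBasis ℂ H).choose_spec.choose

/-- `B` is trace class iff `Tr |B| < ∞`, where `|B| = √(B⋆ B)`. -/
def IsTraceClass (B : H →L[ℂ] H) : Prop :=
  Summable fun i => (inner ℂ (stdBasis H i) (CFC.abs B (stdBasis H i))).re

/-- An everywhere defined linear operator is trace class if it is a bounded operator which is
trace class. -/
def IsTraceClassLin (T : H →ₗ[ℂ] H) : Prop :=
  ∃ B : H →L[ℂ] H, (B : H →ₗ[ℂ] H) = T ∧ IsTraceClass B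

/-- The trace `∑ i, ⟨e i, T (e i)⟩`, meaningful for trace class `T`. -/
def trace (T : H →ₗ[ℂ] H) : ℂ := ∑' i, inner ℂ (stdBasis H i) (T (stdBasis H i))

end Trace

/-! ### O⋆-algebras and their state spaces -/

section OStar

variable {H : Type*} [NormedAddCommGroup H] [InnerProductSpace ℂ H] [CompleteSpace H]

/-- An O⋆-algebra (with unit) on the dense subspace `D` of `H`: a unital subalgebra of the algebra
of linear maps `D → D` such that each member `A` has a formal adjoint `A† = A⋆|_D`, again mapping
`D` into `D`, which is a member as well. -/
structure OStarAlgebra (D : Submodule ℂ H) extends Subalgebra ℂ (Module.End ℂ D) where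
  dense : Dense (D : Set H)
  exists_adjoint : ∀ A ∈ carrier, ∃ B ∈ carrier, ∀ x y : D,
    inner ℂ ((A x : D) : H) (y : H) = inner ℂ (x : H) ((B y : D) : H)

variable {D : Submodule ℂ H}

/-- A linear map `D → D` as a partially defined operator on `H` with domain `D`. -/
def toPMap (A : Module.End ℂ D) : H →ₗ.[ℂ] H := ⟨D, D.subtype ∘ₗ A⟩

/-- Essential self-adjointness: the closure exists and is self-adjoint. -/
def IsESA (A : Module.End ℂ D) : Prop :=
  (toPMap A).IsClosable ∧ IsSelfAdjoint (toPMap A).closure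

/-- The operator `A T` on `H`, for a bounded operator `T` mapping `H` into `D`. -/
def comp (A : Module.End ℂ D) (T : H →L[ℂ] H) (hT : ∀ x, T x ∈ D) : H →ₗ[ℂ] H :=
  D.subtype ∘ₗ A ∘ₗ LinearMap.codRestrict D (T : H →ₗ[ℂ] H) hT

/-- The set `𝒯₁(M)` of trace class operators `T` with `T H ⊆ D`, `T⋆ H ⊆ D` and `A T`, `A T⋆`
trace class for all `A ∈ M`. -/
structure MemT1 (M : OStarAlgebra D) (T : H →L[ℂ] H) : Prop where
  traceClass : IsTraceClass T
  range_mem : ∀ x, T x ∈ D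
  range_adjoint_mem : ∀ x, ContinuousLinearMap.adjoint T x ∈ D
  comp_traceClass : ∀ A ∈ M.carrier, IsTraceClassLin (comp A T range_mem)
  comp_adjoint_traceClass :
    ∀ A ∈ M.carrier, IsTraceClassLin (comp A (ContinuousLinearMap.adjoint T) range_adjoint_mem)

/-- The state space of the O⋆-algebra `M`: the density operators (positive, hence self-adjoint,
of trace one) in `𝒯₁(M)`. -/
structure State (M : OStarAlgebra D) where
  op : H →L[ℂ] H
  memT1 : MemT1 M op
  isPositive : op.IsPositive
  trace_eq_one : trace (op : H →ₗ[ℂ] H) = 1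

/-- `Tr (A ρ)`. -/
def State.expect {M : OStarAlgebra D} (A : Module.End ℂ D) (ρ : State M) : ℂ :=
  trace (comp A ρ.op ρ.memT1.range_mem)

/-- The weak topology on the state space: the weakest one making all the functions
`ρ ↦ Tr (A ρ)`, `A ∈ M`, continuous. -/
instance State.instTopologicalSpace (M : OStarAlgebra D) : TopologicalSpace (State M) :=
  ⨅ A : M.carrier, TopologicalSpace.induced (State.expect (A : Module.End ℂ D)) inferInstance

/-- The real-valued function `a_Q(ρ) = Tr (A ρ)` (for essentially self-adjoint `A` this trace is
real). -/
def aQ {M : OStarAlgebra D} (A : Module.End ℂ D) (ρ : State M) : ℝ := (State.expect A ρ).re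

/-! ### Locally linear functions -/

variable {M : OStarAlgebra D}

/-- A function on an open set `V` of states is locally linear if near every point it is of the
form `a_Q` for an essentially self-adjoint `A ∈ M`. -/
def IsLocallyLinear (V : Opens (State M)) (f : V → ℝ) : Prop :=
  ∀ ρ : V, ∃ N : Opens (State M), (ρ : State M) ∈ N ∧ N ≤ V ∧
    ∃ A ∈ M.carrier, IsESA A ∧ ∀ σ : V, (σ : State M) ∈ N → f σ = aQ A (σ : State M)

/-- The locally linear qr-numbers defined to extent `V`: the sections over `V` of the sheaf of
locally linear functions. -/
def LocLin (V : Opens (State M)) : Type _ := {f : V → ℝ // IsLocallyLinear V f}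

/-- Restriction of locally linear functions. -/
def LocLin.restrict {V V' : Opens (State M)} (h : V' ≤ V) (a : LocLin V) : LocLin V' :=
  ⟨fun ρ => a.1 ⟨ρ, h ρ.2⟩, fun ρ => by
    obtain ⟨N, hρ, -, A, hA, hesa, hN⟩ := a.2 ⟨ρ, h ρ.2⟩
    exact ⟨N ⊓ V', ⟨hρ, ρ.2⟩, inf_le_right, A, hA, hesa, fun σ hσ => hN ⟨σ, h σ.2⟩ hσ.1⟩⟩

/-- A function, defined to extent `W`, from the sheaf of locally linear qr-numbers to the sheaf of
Dedekind qr-numbers (continuous real functions): for every open `V ⊆ W` it maps sections over `V`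
to sections over `V`, compatibly with restriction. -/
structure QrMap (M : OStarAlgebra D) (W : Opens (State M)) where
  app : ∀ V : Opens (State M), V ≤ W → LocLin V → C(V, ℝ)
  naturality : ∀ (V V' : Opens (State M)) (hV : V ≤ W) (h : V' ≤ V) (a : LocLin V) (ρ : V'),
    app V' (h.trans hV) (a.restrict h) ρ = app V hV a ⟨ρ, h ρ.2⟩

/-! ### Germs, prolongation by zero -/

section Germs

variable {X : Type*} [TopologicalSpace X]

/-- The germ at `x ∈ V` of a function on the open set `V` (its extension off `V` is
irrelevant). -/
def germ {V : Opens X} (f : V → ℝ) (x : X) : Germ (𝓝 x) ℝ :=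
  ((Function.extend Subtype.val f 0 : X → ℝ) : Germ (𝓝 x) ℝ)

theorem germ_eq_iff {V V' : Opens X} (f : V → ℝ) (g : V' → ℝ) {x : X} (hx : x ∈ V)
    (hx' : x ∈ V') :
    germ f x = germ g x ↔ ∃ N : Opens X, x ∈ N ∧ ∃ (h : N ≤ V) (h' : N ≤ V'),
      ∀ y : N, f ⟨y, h y.2⟩ = g ⟨y, h' y.2⟩ := by
  have key : ∀ {U : Opens X} (k : U → ℝ) (y : X) (hy : y ∈ U),
      Function.extend Subtype.val k 0 y = k ⟨y, hy⟩ := fun k y hy =>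
    Subtype.val_injective.extend_apply k 0 ⟨y, hy⟩
  unfold germ
  rw [Germ.coe_eq]
  constructor
  · intro h
    obtain ⟨t, ht, hto, hxt⟩ := mem_nhds_iff.1 h
    refine ⟨⟨t, hto⟩ ⊓ V ⊓ V', ⟨⟨hxt, hx⟩, hx'⟩, inf_le_left.trans inf_le_right, inf_le_right,
      fun y => ?_⟩
    have := ht y.2.1.1
    change _ = _ at this
    rwa [key f y y.2.1.2, key g y y.2.2] at this
  · rintro ⟨N, hxN, h, h', hN⟩
    filter_upwards [N.isOpen.mem_nhds hxN] with y hy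
    rw [key f y (h hy), key g y (h' hy)]
    exact hN ⟨y, hy⟩

/-- Let `P` single out the sections of a sheaf of real functions on `X`. A family `s` of germs, one
at each point of the open set `U`, is a section over `U` of the prolongation by zero of the
restriction of this sheaf to the subset `A` if it is zero at the points of `U` outside `A`, and on
`U ∩ A` it is locally given by the germs of a section of the sheaf. -/
def IsProlongedSection (P : ∀ V : Opens X, (V → ℝ) → Prop) (A : Set X) (U : Opens X)
    (s : ∀ x : U, Germ (𝓝 (x : X)) ℝ) : Prop :=
  (∀ x : U, (x : X) ∉ A → s x = 0) ∧
  ∀ x : U, (x : X) ∈ A → ∃ V : Opens X, (x : X) ∈ V ∧ V ≤ U ∧ ∃ f : V → ℝ, P V f ∧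
    ∀ y : U, (y : X) ∈ V → (y : X) ∈ A → s y = germ f (y : X)

/-- The logical extent of the statement `s² ≠ 0`: the largest open subset of `U` at all points of
which the square of the value of `s` is non-zero. -/
def sqNeZeroExtent (U : Opens X) (s : ∀ x : U, Germ (𝓝 (x : X)) ℝ) : Opens X :=
  Opens.interior {x | ∃ h : x ∈ U, (s ⟨x, h⟩).value ^ 2 ≠ 0}

/-- `s` is an intuitionistic nilsquare infinitesimal: the negation of `s² ≠ 0` holds to the full
extent `U`, negation being the (Heyting) complement in the lattice of open sets. -/
def IsIntuitionisticNilsquare (U : Opens X) (s : ∀ x : U, Germ (𝓝 (x : X)) ℝ) : Prop :=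
  U ≤ (sqNeZeroExtent U s)ᶜ

end Germs

/-- Infinitesimal locally linear qr-numbers with support `A`, defined to extent `U`
(for `A` with empty interior). -/
def IsInfinitesimalLocLin (A : Set (State M)) (U : Opens (State M))
    (s : ∀ ρ : U, Germ (𝓝 (ρ : State M)) ℝ) : Prop :=
  IsProlongedSection (fun V f => IsLocallyLinear V f) A U s

/-- Infinitesimal (Dedekind) qr-numbers with support `A`, defined to extent `U`
(for `A` with empty interior). -/
def IsInfinitesimalQr (A : Set (State M)) (U : Opens (State M))
    (s : ∀ ρ : U, Germ (𝓝 (ρ : State M)) ℝ) : Prop :=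
  IsProlongedSection (fun _ f => Continuous f) A U s

open Classical in
/-- The action of `F` on germs of locally linear functions: at a point of `W` the germ of `a` is
sent to the germ of `F a`; at a point outside `W` the result is zero. -/
def QrMap.mapGerm {W : Opens (State M)} (F : QrMap M W) (ρ : State M)
    (γ : Germ (𝓝 ρ) ℝ) : Germ (𝓝 ρ) ℝ :=
  if h : ∃ p : Σ V : {V : Opens (State M) // V ≤ W ∧ ρ ∈ V}, LocLin V.1, germ p.2.1 ρ = γ then
    germ (F.app h.choose.1.1 h.choose.1.2.1 h.choose.2) ρ
  else 0

/-- The action on germs does not depend on the chosen representative. -/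
theorem QrMap.mapGerm_germ {W : Opens (State M)} (F : QrMap M W) {V : Opens (State M)}
    (hV : V ≤ W) (a : LocLin V) {ρ : State M} (hρ : ρ ∈ V) :
    F.mapGerm ρ (germ a.1 ρ) = germ (F.app V hV a) ρ := by
  have h : ∃ p : Σ V : {V : Opens (State M) // V ≤ W ∧ ρ ∈ V}, LocLin V.1,
      germ p.2.1 ρ = germ a.1 ρ := ⟨⟨⟨V, hV, hρ⟩, a⟩, rfl⟩
  unfold QrMap.mapGerm
  rw [dif_pos h]
  obtain ⟨N, hN, h1, h2, he⟩ := (germ_eq_iff _ _ h.choose.1.2.2 hρ).1 h.choose_spec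
  refine (germ_eq_iff _ _ h.choose.1.2.2 hρ).2 ⟨N, hN, h1, h2, fun y => ?_⟩
  rw [← F.naturality _ N h.choose.1.2.1 h1 _ y, ← F.naturality _ N hV h2 _ y]
  congr 2
  exact Subtype.ext (funext he)

/-- `F(s)` for a family of germs `s` over `U`. -/
def QrMap.map {W : Opens (State M)} (F : QrMap M W) {U : Opens (State M)}
    (s : ∀ ρ : U, Germ (𝓝 (ρ : State M)) ℝ) : ∀ ρ : U, Germ (𝓝 (ρ : State M)) ℝ :=
  fun ρ => F.mapGerm (ρ : State M) (s ρ)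

end OStar

end QR

end

/-! The identity `F(a)² = a² G(a)` makes `F` preserve zero: where `a` vanishes near a point, `F(a)²`
vanishes there, and so does `F(a)`, since ℝ has no nonzero nilpotents (`QrMap.mapGerm_zero`). Hence
`F` of the given section is still zero off `A`, while on `A` it is locally given by `F` of a local
representative, a continuous function. Nilsquareness needs only the vanishing off `A`: the square
can be nonzero only inside a set without interior, so the extent of that statement is empty and its
pseudo-complement is everything (`isIntuitionisticNilsquare_of_eq_zero`). -/

namespace QR

section

variable {X : Type*} [TopologicalSpace X]

/-- The germ of a function on an open set vanishes iff the function vanishes near the point. -/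
theorem germ_eq_zero_iff {V : Opens X} (f : V → ℝ) {x : X} (hx : x ∈ V) :
    germ f x = 0 ↔ ∃ N : Opens X, x ∈ N ∧ ∃ h : N ≤ V, ∀ y : N, f ⟨y, h y.2⟩ = 0 := by
  -- `germ` extends by zero off `V`, so the zero section extends to the zero function and the
  -- criterion for equal germs applies.
  have hz : germ (fun _ : V => (0 : ℝ)) x = 0 := by
    unfold germ
    refine congrArg _ (funext fun y => ?_)
    by_cases hy : ∃ v : V, (v : X) = y
    · obtain ⟨v, rfl⟩ := hy
      exact Subtype.val_injective.extend_apply _ _ v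
    · exact Function.extend_apply' _ _ _ hy
  rw [← hz, germ_eq_iff _ _ hx hx]
  exact ⟨fun ⟨N, hN, h, _, e⟩ => ⟨N, hN, h, e⟩, fun ⟨N, hN, h, e⟩ => ⟨N, hN, h, h, e⟩⟩

/-- A section of germs vanishing off a set with empty interior is an intuitionistic nilsquare
infinitesimal. -/
theorem isIntuitionisticNilsquare_of_eq_zero {A : Set X} (hA : interior A = ∅) {U : Opens X}
    {s : ∀ x : U, Germ (𝓝 (x : X)) ℝ} (hs : ∀ x : U, (x : X) ∉ A → s x = 0) :
    IsIntuitionisticNilsquare U s := by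
  have hsub : {x | ∃ h : x ∈ U, (s ⟨x, h⟩).value ^ 2 ≠ 0} ⊆ A := by
    rintro x ⟨hx, hne⟩
    by_contra hxA
    rw [hs ⟨x, hx⟩ hxA] at hne
    exact hne (zero_pow two_ne_zero)
  have hbot : sqNeZeroExtent U s = ⊥ :=
    Opens.ext (Set.subset_eq_empty (interior_mono hsub) hA)
  rw [IsIntuitionisticNilsquare, hbot, compl_bot]
  exact le_top

end

section

variable {H : Type*} [NormedAddCommGroup H] [InnerProductSpace ℂ H] [CompleteSpace H]
  {D : Submodule ℂ H} {M : OStarAlgebra D}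

theorem germ_restrict {V V' : Opens (State M)} (h : V' ≤ V) (a : LocLin V) {ρ : State M}
    (hρ : ρ ∈ V') : germ (a.restrict h).1 ρ = germ a.1 ρ :=
  (germ_eq_iff _ _ hρ (h hρ)).2 ⟨V', hρ, le_rfl, h, fun _ => rfl⟩

/-- If `F(a)² = a² G(a)`, then `F` maps the zero germ to the zero germ. -/
theorem QrMap.mapGerm_zero {W : Opens (State M)} (F G : QrMap M W)
    (hFG : ∀ (V : Opens (State M)) (hV : V ≤ W) (a : LocLin V) (ρ : V),
      (F.app V hV a ρ) ^ 2 = (a.1 ρ) ^ 2 * G.app V hV a ρ) (ρ : State M) :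
    F.mapGerm ρ 0 = 0 := by
  -- The negative case covers every `ρ` outside `W`; there `mapGerm` takes its default value zero.
  by_cases h : ∃ p : Σ V : {V : Opens (State M) // V ≤ W ∧ ρ ∈ V}, LocLin V.1, germ p.2.1 ρ = 0
  · obtain ⟨⟨⟨V, hV, hρ⟩, a⟩, ha⟩ := h
    obtain ⟨N, hN, hNV, hz⟩ := (germ_eq_zero_iff a.1 hρ).1 ha
    -- The first rewrite replaces the zeros on both sides by the germ of `a`; the last one restores
    -- the right-hand side.
    rw [← ha, F.mapGerm_germ hV a hρ, ha]
    refine (germ_eq_zero_iff _ hρ).2 ⟨N, hN, hNV, fun y => ?_⟩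
    have hsq := hFG V hV a ⟨y, hNV y.2⟩
    rw [hz y, zero_pow two_ne_zero, zero_mul] at hsq
    exact (pow_eq_zero_iff two_ne_zero).1 hsq
  · exact dif_neg h

end

end QR

theorem theorem6 {H : Type*} [NormedAddCommGroup H] [InnerProductSpace ℂ H] [CompleteSpace H]
    {D : Submodule ℂ H} (M : QR.OStarAlgebra D)
    (W : TopologicalSpace.Opens (QR.State M)) (F G : QR.QrMap M W)
    (hFG : ∀ (V : TopologicalSpace.Opens (QR.State M)) (hV : V ≤ W) (a : QR.LocLin V) (ρ : V),
      (F.app V hV a ρ) ^ 2 = (a.1 ρ) ^ 2 * G.app V hV a ρ)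
    (A : Set (QR.State M)) (hAW : A ⊆ W) (hA : interior A = ∅)
    (U : TopologicalSpace.Opens (QR.State M))
    (a : ∀ ρ : U, Filter.Germ (nhds (ρ : QR.State M)) ℝ)
    (ha : QR.IsInfinitesimalLocLin A U a) :
    QR.IsInfinitesimalQr A U (F.map a) ∧ QR.IsIntuitionisticNilsquare U (F.map a) := by
  have hzero : ∀ ρ : U, (ρ : QR.State M) ∉ A → F.map a ρ = 0 := fun ρ hρ => by
    rw [QR.QrMap.map, ha.1 ρ hρ, F.mapGerm_zero G hFG]
  refine ⟨⟨hzero, fun ρ hρ => ?_⟩, QR.isIntuitionisticNilsquare_of_eq_zero hA hzero⟩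
  obtain ⟨V, hρV, hVU, f, hf, hgerm⟩ := ha.2 ρ hρ
  -- `F` acts only on sections inside `W`, so the representative is cut down to `V ⊓ W`; this still
  -- contains `ρ` because `A ⊆ W`.
  let b : QR.LocLin (V ⊓ W) := QR.LocLin.restrict inf_le_left ⟨f, hf⟩
  refine ⟨V ⊓ W, ⟨hρV, hAW hρ⟩, inf_le_left.trans hVU, F.app (V ⊓ W) inf_le_right b,
    (F.app (V ⊓ W) inf_le_right b).continuous, fun σ hσ hσA => ?_⟩
  rw [QR.QrMap.map, hgerm σ hσ.1 hσA, ← F.mapGerm_germ inf_le_right b hσ]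
  exact congrArg _ (QR.germ_restrict inf_le_left ⟨f, hf⟩ hσ).symm
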